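/- Let $C$ be a Cantor space, that is, a topological space homeomorphic to $\{0,1\}^{\mathbf N}$, and let $T\colon C\to C$ be a minimal homeomorphism, i.e. the only closed subsets $A\subseteq C$ with $T(A)=A$ are $\varnothing$ and $C$. Let $[[T]]$ be the topological full group of $(T,C)$: the group, under composition, of all homeomorphisms $g$ of $C$ for which there is a partition of $C$ into open subsets such that on each piece $g$ coincides with some power $T^k$, $k\in\mathbf Z$. Then $[[T]]$, regarded as a discrete group, is amenable: there is a finitely additive probability measure, defined on all subsets of $[[T]]$, that is invariant under left translation. -/

import Mathlib

open scoped Pointwise ENNReal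

/-- A topological space is a Cantor space if it is homeomorphic to `{0,1}^ℕ` with the product
topology of discrete spaces. -/
def IsCantorSpace (C : Type*) [TopologicalSpace C] : Prop :=
  Nonempty (C ≃ₜ (ℕ → Bool))

/-- A homeomorphism `T` is minimal if the only closed `T`-invariant subsets are the empty set and
the whole space. -/
def IsMinimalHomeo {C : Type*} [TopologicalSpace C] (T : C ≃ₜ C) : Prop :=
  ∀ A : Set C, IsClosed A → T '' A = A → A = ∅ ∨ A = Set.univ

/-- The topological full group `[[T]]`: the group of all homeomorphisms `g` for which there is a
locally constant `n : C → ℤ` with `g x = T ^ (n x) x` for every `x`. The fibres of `n` are the open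
(and hence clopen) pieces of a partition of `C`, and `g` is `T ^ k` on the fibre over `k`. -/
def topologicalFullGroup {C : Type*} [TopologicalSpace C] (T : C ≃ₜ C) : Subgroup (C ≃ₜ C) where
  carrier := {g | ∃ n : C → ℤ, IsLocallyConstant n ∧ ∀ x, g x = (T ^ n x) x}
  mul_mem' := by
    rintro g h ⟨n, hn, hg⟩ ⟨m, hm, hh⟩
    refine ⟨fun x => n (h x) + m x, (hn.comp_continuous h.continuous).add hm, fun x => ?_⟩
    rw [zpow_add, Homeomorph.mul_apply, Homeomorph.mul_apply, hg (h x), ← hh x]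
  one_mem' := ⟨fun _ => 0, IsLocallyConstant.const 0, fun x => by simp⟩
  inv_mem' := by
    rintro g ⟨n, hn, hg⟩
    refine ⟨fun x => -n (g⁻¹ x), (hn.comp_continuous (g⁻¹).continuous).neg, fun x => ?_⟩
    have h := hg (g⁻¹ x)
    rw [← Homeomorph.mul_apply, mul_inv_cancel, Homeomorph.one_apply] at h
    have key : (T ^ (-n (g⁻¹ x))) x = (T ^ (-n (g⁻¹ x))) ((T ^ n (g⁻¹ x)) (g⁻¹ x)) :=
      congrArg _ h
    rw [key, ← Homeomorph.mul_apply, ← zpow_add, neg_add_cancel, zpow_zero, Homeomorph.one_apply]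

/-- A (discrete) group is amenable if it carries a left-invariant mean, that is, a left-invariant
finitely additive probability measure defined on all of its subsets. -/
def IsAmenableGroup (G : Type*) [Group G] : Prop :=
  ∃ m : Set G → ℝ≥0∞, m Set.univ = 1 ∧
    (∀ s t : Set G, Disjoint s t → m (s ∪ t) = m s + m t) ∧
    ∀ (g : G) (s : Set G), m (g • s) = m s

/-! By minimality every orbit is infinite and dense, so `[[T]]` acts faithfully on a single orbit,
identified with `ℤ`, by permutations of bounded displacement; compactness makes every finite pattern
of this action recur with bounded gaps. Such permutations preserve the class of half lines, the
subsets of `ℤ` that agree with `ℕ` up to a finite set.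

Stabilizers of half lines are locally finite, hence amenable: recurrence yields invariant translates
of the half line with bounded gaps, and these trap every orbit
(`isAmenableGroup_stabilizer_halfLines`).

Half lines also carry almost invariant probability measures: put `j` in the set independently with
probability `sin² (θ j)`, where `θ` climbs slowly from `0` to `π / 2`. A group element changes
`O(n)` angles by `O(1/n)` each, so the overlap of the square-root densities is `1 - O(1/n)`
(`tendsto_tsum_abs_amplitude_smul_sub`). Averaging means of the stabilizers against these measures
gives a mean on the group (`isAmenableGroup_of_action`). -/

open Filter Topology

/-! ### Invariant means and criteria for amenability -/

/-- Approximately invariant finitely additive probability measures yield amenability. -/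
theorem isAmenableGroup_of_approx {G ι : Type*} [Group G] (l : Filter ι) [l.NeBot]
    (m : ι → Set G → ℝ) (h0 : ∀ i s, 0 ≤ m i s) (h1 : ∀ i, m i Set.univ = 1)
    (hadd : ∀ i s t, Disjoint s t → m i (s ∪ t) = m i s + m i t)
    (hinv : ∀ (g : G) s, Tendsto (fun i => m i (g • s) - m i s) l (𝓝 0)) :
    IsAmenableGroup G := by
  have hle : ∀ i s, m i s ≤ 1 := by
    intro i s
    have h := hadd i s sᶜ disjoint_compl_right
    rw [Set.union_compl_self, h1] at h
    linarith [h0 i sᶜ]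
  -- All values lie in `[0, 1]`, so they converge along an ultrafilter refining `l`.
  let U := Ultrafilter.of l
  have hU : (U : Filter ι) ≤ l := Ultrafilter.of_le l
  have hlim : ∀ s, ∃ a : ℝ, Tendsto (fun i => m i s) U (𝓝 a) := by
    intro s
    obtain ⟨a, -, ha⟩ := (isCompact_Icc (a := (0 : ℝ)) (b := 1)).ultrafilter_le_nhds
      (U.map fun i => m i s) (by
        rw [le_principal_iff, Ultrafilter.mem_coe, Ultrafilter.mem_map]
        exact Filter.univ_mem' fun i => ⟨h0 i s, hle i s⟩)
    exact ⟨a, ha⟩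
  choose L hL using hlim
  have hL0 : ∀ s, 0 ≤ L s := fun s => ge_of_tendsto' (hL s) fun i => h0 i s
  refine ⟨fun s => ENNReal.ofReal (L s), ?_, ?_, ?_⟩
  · have : L Set.univ = 1 := tendsto_nhds_unique (hL _) (by simp [h1])
    simp [this]
  · intro s t hst
    have : L (s ∪ t) = L s + L t := by
      refine tendsto_nhds_unique (hL _) ?_
      simp only [hadd _ s t hst]
      exact (hL s).add (hL t)
    simp only [this]
    exact ENNReal.ofReal_add (hL0 s) (hL0 t)
  · intro g s
    have : L (g • s) - L s = 0 :=
      tendsto_nhds_unique ((hL _).sub (hL _)) ((hinv g s).mono_left hU)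
    simp only [sub_eq_zero.1 this]

theorem IsAmenableGroup.exists_real {G : Type*} [Group G] (h : IsAmenableGroup G) :
    ∃ m : Set G → ℝ, (∀ s, 0 ≤ m s) ∧ m Set.univ = 1 ∧
      (∀ s t, Disjoint s t → m (s ∪ t) = m s + m t) ∧ ∀ (g : G) s, m (g • s) = m s := by
  obtain ⟨m, h1, hadd, hinv⟩ := h
  have hfin : ∀ s, m s ≠ ∞ := by
    intro s hs
    have h := hadd s sᶜ disjoint_compl_right
    rw [Set.union_compl_self, h1, hs, top_add] at h
    exact ENNReal.one_ne_top h
  refine ⟨fun s => (m s).toReal, fun s => ENNReal.toReal_nonneg, by simp [h1], ?_, ?_⟩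
  · intro s t hst
    simp only [hadd s t hst]
    exact ENNReal.toReal_add (hfin s) (hfin t)
  · intro g s
    simp only [hinv]

/-- Locally finite groups are amenable. -/
theorem isAmenableGroup_of_locallyFinite {G : Type*} [Group G]
    (h : ∀ F : Finset G, Finite (Subgroup.closure (F : Set G))) : IsAmenableGroup G := by
  classical
  have hfin : ∀ (F : Finset G) (s : Set G), (s ∩ Subgroup.closure (F : Set G)).Finite :=
    fun F s => (Set.toFinite (Subgroup.closure (F : Set G) : Set G)).subset
      Set.inter_subset_right
  refine isAmenableGroup_of_approx (ι := Finset G) atTop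
    (fun F s => ((s ∩ Subgroup.closure (F : Set G)).ncard : ℝ) /
      ((Subgroup.closure (F : Set G) : Set G).ncard : ℝ)) (fun F s => by positivity)
    (fun F => ?_) (fun F s t hst => ?_) (fun g s => ?_)
  · have : (Subgroup.closure (F : Set G) : Set G).ncard ≠ 0 :=
      (Set.ncard_pos (Set.toFinite _)).2 ⟨1, one_mem _⟩ |>.ne'
    simp only [Set.univ_inter]
    field_simp
  · rw [← add_div, Set.union_inter_distrib_right, Set.ncard_union_eq _ (hfin F s) (hfin F t)]
    · push_cast
      rfl
    · exact hst.mono Set.inter_subset_left Set.inter_subset_left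
  · refine tendsto_const_nhds.congr' ?_
    filter_upwards [eventually_ge_atTop {g}] with F hF
    have hg : g ∈ Subgroup.closure (F : Set G) :=
      Subgroup.subset_closure (by simpa using hF)
    have : (g • s) ∩ Subgroup.closure (F : Set G) =
        g • (s ∩ (Subgroup.closure (F : Set G) : Set G)) := by
      ext x
      simp only [Set.mem_inter_iff, Set.mem_smul_set_iff_inv_smul_mem, SetLike.mem_coe,
        smul_eq_mul, Subgroup.mul_mem_cancel_left _ (inv_mem hg)]
    rw [this, Set.ncard_smul_set, sub_self]

/-- An equivariant field of means for an action with amenable stabilizers. -/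
theorem exists_equivariant_means {G X : Type*} [Group G] [MulAction G X]
    (h : ∀ x : X, IsAmenableGroup (MulAction.stabilizer G x)) :
    ∃ m : X → Set G → ℝ, (∀ x s, 0 ≤ m x s) ∧ (∀ x, m x Set.univ = 1) ∧
      (∀ x s t, Disjoint s t → m x (s ∪ t) = m x s + m x t) ∧
      ∀ (g : G) x s, m (g • x) (g • s) = m x s := by
  choose ν ν0 ν1 νadd νinv using fun x => (h x).exists_real
  -- The stabilizer mean pushed forward to the coset of `a`; by invariance it depends only on `a •
  -- x`.
  let N : X → G → Set G → ℝ := fun x a s => ν x {b | a * (b : G) ∈ s}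
  have hN : ∀ x a b s, a • x = b • x → N x a s = N x b s := by
    intro x a b s hab
    have hmem : a⁻¹ * b ∈ MulAction.stabilizer G x := by
      rw [MulAction.mem_stabilizer_iff, mul_smul, ← hab, inv_smul_smul]
    change ν x _ = ν x _
    rw [← νinv x ⟨_, hmem⟩ {c | b * (c : G) ∈ s}]
    congr 1
    ext c
    simp [Set.mem_smul_set_iff_inv_smul_mem, mul_assoc]
  have hNg : ∀ x a s (g : G), N x (g * a) (g • s) = N x a s := by
    intro x a s g
    simp [N, Set.mem_smul_set_iff_inv_smul_mem, mul_assoc]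
  let r : X → X := fun x => (Quotient.mk (MulAction.orbitRel G X) x).out
  have hr : ∀ (g : G) x, r (g • x) = r x := by
    intro g x
    have : (Quotient.mk (MulAction.orbitRel G X) (g • x)) = Quotient.mk _ x :=
      Quotient.sound (MulAction.mem_orbit x g)
    simp only [r, this]
  have hγ : ∀ x, ∃ a : G, a • r x = x := by
    intro x
    have : (MulAction.orbitRel G X) (r x) x := Quotient.exact (Quotient.out_eq _)
    exact (MulAction.orbitRel G X).symm this
  choose γ hγ using hγ
  refine ⟨fun x s => N (r x) (γ x) s, fun x s => ν0 _ _, fun x => ?_, fun x s t hst => ?_,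
    fun g x s => ?_⟩
  · simp [N, ν1]
  · refine νadd _ _ _ ?_
    exact Set.disjoint_left.2 fun c hc hc' => Set.disjoint_left.1 hst hc hc'
  · change N (r (g • x)) (γ (g • x)) (g • s) = N (r x) (γ x) s
    rw [← hNg (r x) (γ x) s g, hr]
    apply hN
    rw [mul_smul, hγ x, ← hr g x, hγ]

/-- A group acting with amenable stabilizers and almost invariant finitely supported probability
measures is amenable. -/
theorem isAmenableGroup_of_action {G X : Type*} [Group G] [MulAction G X]
    (h : ∀ x : X, IsAmenableGroup (MulAction.stabilizer G x))
    (p : ℕ → X → ℝ) (hfin : ∀ n, (Function.support (p n)).Finite) (h0 : ∀ n x, 0 ≤ p n x)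
    (h1 : ∀ n, ∑' x, p n x = 1)
    (hinv : ∀ g : G, Tendsto (fun n => ∑' x, |p n (g • x) - p n x|) atTop (𝓝 0)) :
    IsAmenableGroup G := by
  obtain ⟨m, m0, m1, madd, minv⟩ := exists_equivariant_means h
  have hle : ∀ x s, m x s ≤ 1 := by
    intro x s
    have h := madd x s sᶜ disjoint_compl_right
    rw [Set.union_compl_self, m1] at h
    linarith [m0 x sᶜ]
  have hp : ∀ n, Summable (p n) := fun n => summable_of_hasFiniteSupport (hfin n)
  have hpg : ∀ n (g : G), Summable (fun x => p n (g • x)) := fun n g =>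
    (MulAction.toPerm g).summable_iff.2 (hp n)
  have hs : ∀ n s, Summable (fun x => p n x * m x s) := fun n s =>
    Summable.of_nonneg_of_le (fun x => mul_nonneg (h0 n x) (m0 x s))
      (fun x => mul_le_of_le_one_right (h0 n x) (hle x s)) (hp n)
  have hsg : ∀ n s (g : G), Summable (fun x => p n (g • x) * m x s) := fun n s g =>
    Summable.of_nonneg_of_le (fun x => mul_nonneg (h0 n _) (m0 x s))
      (fun x => mul_le_of_le_one_right (h0 n _) (hle x s)) (hpg n g)
  refine isAmenableGroup_of_approx atTop (fun n s => ∑' x, p n x * m x s)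
    (fun n s => tsum_nonneg fun x => mul_nonneg (h0 n x) (m0 x s)) (fun n => by simp [m1, h1])
    (fun n s t hst => ?_) (fun g s => ?_)
  · rw [← (hs n s).tsum_add (hs n t)]
    simp only [madd _ s t hst, mul_add]
  · refine squeeze_zero_norm (fun n => ?_) (hinv g)
    have e : ∑' x, p n x * m x (g • s) = ∑' x, p n (g • x) * m x s := by
      rw [← (MulAction.toPerm g).tsum_eq]
      simp [minv]
    have habs : Summable (fun x => |p n (g • x) - p n x|) := ((hpg n g).sub (hp n)).abs
    rw [e, ← (hsg n s g).tsum_sub (hs n s)]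
    have hb : ∀ x, ‖p n (g • x) * m x s - p n x * m x s‖ ≤ |p n (g • x) - p n x| := by
      intro x
      rw [← sub_mul, Real.norm_eq_abs, abs_mul, abs_of_nonneg (m0 x s)]
      exact mul_le_of_le_one_right (abs_nonneg _) (hle x s)
    exact tsum_of_norm_bounded habs.hasSum hb

/-! ### Half lines and their locally finite stabilizers -/

/-- A finitely generated group acting faithfully with orbits of bounded size is finite. -/
theorem finite_of_bounded_orbits {H Y : Type*} [Group H] [MulAction H Y] [FaithfulSMul H Y]
    (F : Finset H) (hF : Subgroup.closure (F : Set H) = ⊤) (K : ℕ)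
    (hK : ∀ y : Y, ∃ s : Finset Y, s.card ≤ K ∧ ∀ h : H, h • y ∈ s) : Finite H := by
  classical
  -- Finitely many homomorphisms suffice to separate `H`: each orbit embeds in `Fin K`, and the
  -- action on it extends by the identity.
  have hhom : Finite (H →* Equiv.Perm (Fin K)) := by
    refine Finite.of_injective (β := F → Equiv.Perm (Fin K)) (fun φ x => φ x) ?_
    intro φ ψ hφψ
    exact MonoidHom.eq_of_eqOn_dense hF fun x hx => congrFun hφψ ⟨x, hx⟩
  refine Finite.of_injective
    (β := (H →* Equiv.Perm (Fin K)) → Equiv.Perm (Fin K)) (fun h φ => φ h) ?_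
  intro a b hab
  refine FaithfulSMul.eq_of_smul_eq_smul (α := Y) fun y => ?_
  obtain ⟨s, hsK, hs⟩ := hK y
  have hsub : ∀ z : MulAction.orbit H y, (z : Y) ∈ s := by
    rintro ⟨_, h, rfl⟩
    exact hs h
  let ι : MulAction.orbit H y ↪ Fin K :=
    (⟨fun z => ⟨z, hsub z⟩, fun z w hzw => by simpa [Subtype.ext_iff] using hzw⟩ :
      MulAction.orbit H y ↪ s).trans
        (s.equivFin.toEmbedding.trans (Fin.castLEEmb hsK))
  have h := congrFun hab
    ((Equiv.Perm.viaEmbeddingHom ι).comp (MulAction.toPermHom H (MulAction.orbit H y)))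
  have h' := Equiv.Perm.viaEmbeddingHom_injective ι h
  have h'' := DFunLike.congr_fun h' ⟨y, MulAction.mem_orbit_self y⟩
  simpa [Subtype.ext_iff] using h''

/-- The subsets of `ℤ` that agree with `ℕ` up to a finite set, as a `G`-set, for an action of `G`
on `ℤ` by permutations of bounded displacement. -/
def halfLines {G : Type*} [Group G] [MulAction G ℤ]
    (hbd : ∀ g : G, ∃ d : ℕ, ∀ j : ℤ, |g • j - j| ≤ d) : SubMulAction G (Set ℤ) where
  carrier := {S | ∃ m : ℕ, ∀ j : ℤ, (j < -m → j ∉ S) ∧ (m < j → j ∈ S)}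
  smul_mem' := by
    rintro g S ⟨m, hm⟩
    obtain ⟨d, hd⟩ := hbd g⁻¹
    refine ⟨m + d, fun j => ?_⟩
    have := abs_le.1 (hd j)
    simp only [Set.mem_smul_set_iff_inv_smul_mem]
    push_cast
    exact ⟨fun hj => (hm _).1 (by linarith), fun hj => (hm _).2 (by linarith)⟩

/-- Where the pattern of the generators near `0` recurs at `t`, the translate `S + t` is invariant
too. Translates on either side of a point bound its orbit uniformly, so finitely generated subgroups
are finite. -/
theorem isAmenableGroup_stabilizer_halfLines {G : Type*} [Group G] [MulAction G ℤ]
    [FaithfulSMul G ℤ] (hbd : ∀ g : G, ∃ d : ℕ, ∀ j : ℤ, |g • j - j| ≤ d)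
    (hub : ∀ (F : Finset G) (n : ℕ), ∃ k : ℕ, ∀ j : ℤ, ∃ t : ℤ, |t - j| ≤ k ∧
      ∀ g ∈ F, ∀ i : ℤ, |i| ≤ n → g • (i + t) = g • i + t)
    (S : halfLines hbd) : IsAmenableGroup (MulAction.stabilizer G S) := by
  classical
  refine isAmenableGroup_of_locallyFinite ?_
  obtain ⟨S, m, hm⟩ := S
  set S' : halfLines hbd := ⟨S, m, hm⟩
  intro F
  have hstab : ∀ g : MulAction.stabilizer G S', ∀ i : ℤ, (g : G) • i ∈ S ↔ i ∈ S := by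
    intro g i
    have h : (g : G) • S = S := congrArg Subtype.val g.2
    conv_lhs => rw [← h]
    exact Set.smul_mem_smul_set_iff
  have hbd' := hbd
  choose d hd using hbd'
  set D : ℕ := F.sup fun g => d g
  -- The margin `D` ensures that a generator cannot bring a point beyond this window back into `[-m,
  -- m]`, where `S` is irregular.
  obtain ⟨k, hk⟩ := hub (F.image Subtype.val) (m + D)
  have hinv : ∀ j : ℤ, ∃ t : ℤ, |t - j| ≤ k ∧
      ∀ h ∈ Subgroup.closure (F : Set (MulAction.stabilizer G S')), ∀ i : ℤ,
        (h : G) • i - t ∈ S ↔ i - t ∈ S := by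
    intro j
    obtain ⟨t, ht, hpat⟩ := hk j
    refine ⟨t, ht, fun h hh => ?_⟩
    induction hh using Subgroup.closure_induction with
    | mem g hg =>
      intro i
      have hdg : ((d g : ℕ) : ℤ) ≤ D := by
        exact_mod_cast Finset.le_sup (f := fun g : MulAction.stabilizer G S' => d g) hg
      by_cases hi : |i - t| ≤ ((m + D : ℕ) : ℤ)
      · have := hpat g (Finset.mem_image_of_mem _ hg) (i - t) hi
        rw [sub_add_cancel] at this
        rw [this, add_sub_cancel_right, hstab]
      · have h1 := abs_le.1 (hd g i)
        push_cast at hi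
        rcases lt_abs.1 (not_le.1 hi) with hi | hi
        · exact iff_of_true ((hm _).2 (by linarith)) ((hm _).2 (by linarith))
        · exact iff_of_false ((hm _).1 (by linarith)) ((hm _).1 (by linarith))
    | one => simp
    | mul a b _ _ ha hb =>
      intro i
      rw [Subgroup.coe_mul, mul_smul, ha, hb]
    | inv a _ ha =>
      intro i
      rw [← ha, Subgroup.coe_inv, smul_inv_smul]
  have hbound : ∀ h ∈ Subgroup.closure (F : Set (MulAction.stabilizer G S')), ∀ j : ℤ,
      (h : G) • j ∈ Finset.Icc (j - (2 * k + 2 * m + 1)) (j + (2 * k + 2 * m + 1)) := by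
    intro h hh j
    -- The offset puts `j - t` below `-m` and `j - u` above `m`, despite the error `k` in `t` and
    -- `u`.
    obtain ⟨t, ht, hit⟩ := hinv (j + (k + m + 1))
    obtain ⟨u, hu, hiu⟩ := hinv (j - (k + m + 1))
    rw [abs_le] at ht hu
    have h1 : (h : G) • j - t ∉ S := by
      rw [hit h hh]
      exact (hm _).1 (by linarith)
    have h2 : (h : G) • j - u ∈ S := by
      rw [hiu h hh]
      exact (hm _).2 (by linarith)
    have h3 : ¬ (m : ℤ) < (h : G) • j - t := fun hlt => h1 ((hm _).2 hlt)
    have h4 : ¬ (h : G) • j - u < -m := fun hlt => (hm _).1 hlt h2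
    rw [Finset.mem_Icc]
    constructor <;> linarith
  refine finite_of_bounded_orbits (Y := ℤ)
    (H := Subgroup.closure (F : Set (MulAction.stabilizer G S')))
    (F.attach.image fun g => ⟨g.1, Subgroup.subset_closure g.2⟩) ?_
    (2 * (2 * k + 2 * m + 1) + 1) (fun j => ⟨_, ?_, fun h => hbound h.1 h.2 j⟩)
  · convert Subgroup.closure_closure_coe_preimage (k := (F : Set (MulAction.stabilizer G S')))
    ext x
    rw [Finset.mem_coe, Finset.mem_image]
    constructor
    · rintro ⟨g, -, rfl⟩
      exact g.2
    · intro hx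
      exact ⟨⟨x.1, hx⟩, Finset.mem_attach _ _, rfl⟩
  · rw [Int.card_Icc]
    omega

/-! ### Almost invariant product measures on half lines -/

/-- The amplitude at `S` of the infinite tensor product of the unit vectors
`(cos (θ j), sin (θ j))`. -/
noncomputable def amplitude (θ : ℤ → ℝ) (S : Set ℤ) : ℝ :=
  open Classical in ∏ᶠ j, if j ∈ S then Real.sin (θ j) else Real.cos (θ j)

/-- `θ` vanishes near `-∞` and equals `π / 2` near `+∞`. -/
def IsRamp (θ : ℤ → ℝ) (m : ℕ) : Prop :=
  ∀ j : ℤ, (j < -m → θ j = 0) ∧ (m < j → θ j = Real.pi / 2)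

theorem amplitude_union_Ioi {θ : ℤ → ℝ} {m : ℕ} (hθ : IsRamp θ m) {A : Finset ℤ}
    (hA : A ⊆ Finset.Icc (-(m : ℤ)) m) :
    amplitude θ (A ∪ Set.Ioi (m : ℤ)) =
      (∏ j ∈ A, Real.sin (θ j)) * ∏ j ∈ Finset.Icc (-(m : ℤ)) m \ A, Real.cos (θ j) := by
  classical
  rw [amplitude, finprod_eq_prod_of_mulSupport_subset (s := Finset.Icc (-(m : ℤ)) m),
    ← Finset.prod_sdiff hA, mul_comm]
  · congr 1
    · exact Finset.prod_congr rfl fun j hj => if_pos (Or.inl hj)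
    · refine Finset.prod_congr rfl fun j hj => if_neg ?_
      rw [Finset.mem_sdiff, Finset.mem_Icc] at hj
      rintro (h | h)
      · exact hj.2 h
      · exact not_lt.2 hj.1.2 h
  · intro j hj
    rw [Finset.coe_Icc, Set.mem_Icc]
    by_contra hcon
    apply hj
    rcases lt_or_ge j (-m) with h | h
    · simp only
      rw [if_neg, (hθ j).1 h, Real.cos_zero]
      rintro (h' | h')
      · exact absurd (Finset.mem_Icc.1 (hA h')).1 (not_le.2 h)
      · have : (m : ℤ) < j := h'
        omega
    · have h' : (m : ℤ) < j := by
        by_contra h'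
        exact hcon ⟨h, not_lt.1 h'⟩
      simp only
      rw [if_pos (Set.mem_union_right _ (Set.mem_Ioi.2 h')), (hθ j).2 h', Real.sin_pi_div_two]

theorem eq_union_Ioi_of_amplitude_ne_zero {θ : ℤ → ℝ} {m : ℕ} (hθ : IsRamp θ m) {S : Set ℤ}
    (hS : ∃ k : ℕ, ∀ j : ℤ, (j < -k → j ∉ S) ∧ (k < j → j ∈ S)) (h : amplitude θ S ≠ 0) :
    ∃ A ⊆ Finset.Icc (-(m : ℤ)) m, S = (A : Set ℤ) ∪ Set.Ioi (m : ℤ) := by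
  classical
  obtain ⟨k, hk⟩ := hS
  have hne : ∀ j, (if j ∈ S then Real.sin (θ j) else Real.cos (θ j)) ≠ 0 := by
    intro j hj
    refine h ?_
    rw [amplitude]
    refine finprod_eq_zero _ j hj ?_
    -- Almost all factors are `1`, so the `finprod` is a genuine product, not its default value `1`,
    -- and a zero factor kills it.
    refine (Set.finite_Icc (-((m + k : ℕ) : ℤ)) ((m + k : ℕ) : ℤ)).subset fun i hi => ?_
    push_cast
    by_contra hcon
    apply hi
    rcases lt_or_ge i (-(m + k)) with h' | h'
    · simp only
      rw [if_neg ((hk i).1 (by omega)), (hθ i).1 (by omega), Real.cos_zero]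
    · have h'' : (m + k : ℤ) < i := by
        by_contra h''
        exact hcon ⟨h', not_lt.1 h''⟩
      simp only
      rw [if_pos ((hk i).2 (by omega)), (hθ i).2 (by omega), Real.sin_pi_div_two]
  have h1 : ∀ j : ℤ, j < -m → j ∉ S := by
    intro j hj hjS
    have := hne j
    rw [if_pos hjS, (hθ j).1 hj, Real.sin_zero] at this
    exact this rfl
  have h2 : ∀ j : ℤ, (m : ℤ) < j → j ∈ S := by
    intro j hj
    by_contra hjS
    have := hne j
    rw [if_neg hjS, (hθ j).2 hj, Real.cos_pi_div_two] at this
    exact this rfl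
  refine ⟨(Finset.Icc (-(m : ℤ)) m).filter (· ∈ S), Finset.filter_subset _ _, ?_⟩
  ext j
  simp only [Finset.coe_filter, Finset.mem_Icc, Set.mem_union, Set.mem_ofPred_eq, Set.mem_Ioi]
  constructor
  · intro hj
    by_cases hjm : (m : ℤ) < j
    · exact Or.inr hjm
    · exact Or.inl ⟨⟨not_lt.1 fun hlt => h1 j hlt hj, not_lt.1 hjm⟩, hj⟩
  · rintro (hj | hj)
    · exact hj.2
    · exact h2 j hj

/-- Reduces comparing a measure with its translate to comparing two ramps. -/
theorem amplitude_smul {G : Type*} [Group G] [MulAction G ℤ] (g : G) (θ : ℤ → ℝ) (S : Set ℤ) :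
    amplitude θ (g • S) = amplitude (fun j => θ (g • j)) S := by
  classical
  rw [amplitude, amplitude, ← finprod_comp_equiv (MulAction.toPerm g)]
  simp [Set.smul_mem_smul_set_iff]

section

variable {G : Type*} [Group G] [MulAction G ℤ]
  (hbd : ∀ g : G, ∃ d : ℕ, ∀ j : ℤ, |g • j - j| ≤ d)

open Classical in
/-- The half lines that agree with `ℕ` outside the window `[-m, m]`. -/
noncomputable def halfLineWindow (m : ℕ) : Finset (halfLines hbd) :=
  (Finset.Icc (-(m : ℤ)) m).powerset.attach.image fun A =>
    ⟨(A.1 : Set ℤ) ∪ Set.Ioi (m : ℤ), m, fun j => ⟨fun hj h => by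
      have hA := Finset.mem_powerset.1 A.2
      rcases h with h | h
      · exact absurd (Finset.mem_Icc.1 (hA h)).1 (not_le.2 hj)
      · have : (m : ℤ) < j := h
        omega, fun hj => Or.inr hj⟩⟩

theorem amplitude_eq_zero_of_notMem_window {θ : ℤ → ℝ} {m : ℕ} (hθ : IsRamp θ m)
    {S : halfLines hbd} (hS : S ∉ halfLineWindow hbd m) : amplitude θ S = 0 := by
  classical
  by_contra h
  obtain ⟨A, hA, hSA⟩ := eq_union_Ioi_of_amplitude_ne_zero hθ S.2 h
  refine hS (Finset.mem_image.2 ⟨⟨A, Finset.mem_powerset.2 hA⟩, Finset.mem_attach _ _, ?_⟩)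
  exact Subtype.ext hSA.symm

/-- The inner product of product vectors is the product of the inner products: expand each `cos (θ j
- η j)` and sum over subsets of the window. -/
theorem sum_window_amplitude_mul {θ η : ℤ → ℝ} {m : ℕ} (hθ : IsRamp θ m) (hη : IsRamp η m) :
    ∑ S ∈ halfLineWindow hbd m, amplitude θ S * amplitude η S =
      ∏ j ∈ Finset.Icc (-(m : ℤ)) m, Real.cos (θ j - η j) := by
  classical
  have hcos : ∀ j, Real.cos (θ j - η j) =
      Real.sin (θ j) * Real.sin (η j) + Real.cos (θ j) * Real.cos (η j) := fun j => by
    rw [Real.cos_sub, add_comm]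
  simp only [hcos]
  rw [Finset.prod_add, halfLineWindow, Finset.sum_image, ← Finset.sum_attach (Finset.powerset _)]
  · refine Finset.sum_congr rfl fun A _ => ?_
    have hA := Finset.mem_powerset.1 A.2
    simp only [amplitude_union_Ioi hθ hA, amplitude_union_Ioi hη hA, Finset.prod_mul_distrib]
    ring
  · intro A _ B _ hAB
    have h : (A.1 : Set ℤ) ∪ Set.Ioi (m : ℤ) = (B.1 : Set ℤ) ∪ Set.Ioi (m : ℤ) :=
      congrArg Subtype.val hAB
    have hA := Finset.mem_powerset.1 A.2
    have hB := Finset.mem_powerset.1 B.2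
    ext j
    have hj := Set.ext_iff.1 h j
    simp only [Set.mem_union, Set.mem_Ioi, Finset.mem_coe] at hj
    constructor
    · intro hjA
      exact (hj.1 (Or.inl hjA)).resolve_right (not_lt.2 (Finset.mem_Icc.1 (hA hjA)).2)
    · intro hjB
      exact (hj.2 (Or.inl hjB)).resolve_right (not_lt.2 (Finset.mem_Icc.1 (hB hjB)).2)

theorem sum_window_amplitude_sq {θ : ℤ → ℝ} {m : ℕ} (hθ : IsRamp θ m) :
    ∑ S ∈ halfLineWindow hbd m, amplitude θ S ^ 2 = 1 := by
  simp only [sq, sum_window_amplitude_mul hbd hθ hθ, sub_self, Real.cos_zero,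
    Finset.prod_const_one]

/-- Nearby ramps give product measures that are close in total variation. -/
theorem tsum_abs_amplitude_sq_sub_le {θ η : ℤ → ℝ} {m : ℕ} (hθ : IsRamp θ m) (hη : IsRamp η m)
    {δ : ℝ} (hδ : δ ≤ 1) (h : ∀ j, |θ j - η j| ≤ δ) :
    ∑' S : halfLines hbd, |amplitude θ S ^ 2 - amplitude η S ^ 2| ≤
      √(4 * (2 * m + 1) * δ ^ 2) := by
  have hδ0 : 0 ≤ δ := (abs_nonneg _).trans (h 0)
  rw [tsum_eq_sum (s := halfLineWindow hbd m) fun S hS => by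
    simp [amplitude_eq_zero_of_notMem_window hbd hθ hS,
      amplitude_eq_zero_of_notMem_window hbd hη hS]]
  apply Real.le_sqrt_of_sq_le
  set c := ∏ j ∈ Finset.Icc (-(m : ℤ)) m, Real.cos (θ j - η j)
  have hc := sum_window_amplitude_mul hbd hθ hη
  have h1 := sum_window_amplitude_sq hbd hθ
  have h2 := sum_window_amplitude_sq hbd hη
  have hsub : ∑ S ∈ halfLineWindow hbd m, |amplitude θ S - amplitude η S| ^ 2 = 2 - 2 * c := by
    simp only [sq_abs, sub_sq, Finset.sum_add_distrib, Finset.sum_sub_distrib, h1, h2, mul_assoc,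
      ← Finset.mul_sum, hc]
    ring
  have hadd : ∑ S ∈ halfLineWindow hbd m, |amplitude θ S + amplitude η S| ^ 2 = 2 + 2 * c := by
    simp only [sq_abs, add_sq, Finset.sum_add_distrib, h1, h2, mul_assoc,
      ← Finset.mul_sum, hc]
    ring
  have hsub0 : 0 ≤ 2 - 2 * c := hsub ▸ Finset.sum_nonneg fun _ _ => sq_nonneg _
  have hadd0 : 0 ≤ 2 + 2 * c := hadd ▸ Finset.sum_nonneg fun _ _ => sq_nonneg _
  have hcard : ((Finset.Icc (-(m : ℤ)) m).card : ℝ) = 2 * m + 1 := by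
    have : (Finset.Icc (-(m : ℤ)) m).card = 2 * m + 1 := by
      rw [Int.card_Icc]
      omega
    rw [this]
    push_cast
    ring
  -- Bernoulli's inequality, with `2m + 1` factors each at least `1 - δ² / 2`.
  have hclow : 1 - (2 * m + 1) * (δ ^ 2 / 2) ≤ c := by
    have hb := one_add_mul_le_pow (a := -(δ ^ 2 / 2)) (by nlinarith)
      (Finset.Icc (-(m : ℤ)) m).card
    rw [hcard] at hb
    calc 1 - (2 * m + 1) * (δ ^ 2 / 2) = 1 + (2 * m + 1) * (-(δ ^ 2 / 2)) := by ring
      _ ≤ _ := hb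
      _ = ∏ _j ∈ Finset.Icc (-(m : ℤ)) m, (1 + -(δ ^ 2 / 2)) := by rw [Finset.prod_const]
      _ ≤ c := by
        refine Finset.prod_le_prod (fun _ _ => by nlinarith) fun j _ => ?_
        have h3 := Real.one_sub_sq_div_two_le_cos (x := θ j - η j)
        have h4 : (θ j - η j) ^ 2 ≤ δ ^ 2 := sq_le_sq' (abs_le.1 (h j)).1 (abs_le.1 (h j)).2
        linarith
  -- Factor the difference of squares and apply Cauchy–Schwarz.
  calc (∑ S ∈ halfLineWindow hbd m, |amplitude θ S ^ 2 - amplitude η S ^ 2|) ^ 2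
      = (∑ S ∈ halfLineWindow hbd m,
          |amplitude θ S - amplitude η S| * |amplitude θ S + amplitude η S|) ^ 2 := by
        congr 1
        refine Finset.sum_congr rfl fun S _ => ?_
        rw [← abs_mul]
        congr 1
        ring
    _ ≤ (2 - 2 * c) * (2 + 2 * c) := by
        rw [← hsub, ← hadd]
        exact Finset.sum_mul_sq_le_sq_mul_sq _ _ _
    _ ≤ (2 - 2 * c) * 4 := mul_le_mul_of_nonneg_left (by linarith) hsub0
    _ ≤ 4 * (2 * m + 1) * δ ^ 2 := by linarith

/-- The linear ramp of length `n + 1`. -/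
noncomputable def linearRamp (n : ℕ) (j : ℤ) : ℝ :=
  Real.pi / 2 * (max 0 (min 1 ((j : ℝ) / (n + 1))))

theorem isRamp_linearRamp_smul (g : G) (n d : ℕ) (hd : ∀ j : ℤ, |g • j - j| ≤ d) :
    IsRamp (fun j => linearRamp n (g • j)) (n + 1 + d) := by
  intro j
  have := abs_le.1 (hd j)
  have hn : (0 : ℝ) < n + 1 := by positivity
  push_cast
  constructor
  · intro hj
    have h0 : ((g • j : ℤ) : ℝ) ≤ 0 := by exact_mod_cast (by linarith : g • j ≤ 0)
    have h1 : ((g • j : ℤ) : ℝ) / (n + 1) ≤ 0 := div_nonpos_of_nonpos_of_nonneg h0 hn.le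
    simp only [linearRamp]
    rw [max_eq_left ((min_le_right _ _).trans h1), mul_zero]
  · intro hj
    have h0 : (n + 1 : ℝ) ≤ ((g • j : ℤ) : ℝ) := by
      exact_mod_cast (by linarith : (n + 1 : ℤ) ≤ g • j)
    have h1 : 1 ≤ ((g • j : ℤ) : ℝ) / (n + 1) := (one_le_div hn).2 h0
    simp only [linearRamp]
    rw [min_eq_left h1, max_eq_right zero_le_one, mul_one]

theorem abs_linearRamp_sub_le (n : ℕ) (i j : ℤ) :
    |linearRamp n i - linearRamp n j| ≤ Real.pi / 2 * (|((i - j : ℤ) : ℝ)| / (n + 1)) := by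
  have hn : (0 : ℝ) < n + 1 := by positivity
  rw [linearRamp, linearRamp, ← mul_sub, abs_mul, abs_of_pos Real.pi_div_two_pos]
  refine mul_le_mul_of_nonneg_left ?_ Real.pi_div_two_pos.le
  calc _ ≤ |min 1 ((i : ℝ) / (n + 1)) - min 1 ((j : ℝ) / (n + 1))| := by
        simpa only [max_comm (0 : ℝ)] using abs_max_sub_max_le_abs _ _ (0 : ℝ)
    _ ≤ |(i : ℝ) / (n + 1) - (j : ℝ) / (n + 1)| := by
        simpa only [min_comm (1 : ℝ)] using abs_inf_sub_inf_le_abs _ _ (1 : ℝ)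
    _ = _ := by
        rw [← sub_div, abs_div, abs_of_pos hn, Int.cast_sub]

/-- Displacement at most `d` changes each angle by at most `(π / 2) d / (n + 1)`, on a window of
length `O(n)`; the squared bound is `O(n) · O(1/n²)`. -/
theorem tendsto_tsum_abs_amplitude_smul_sub (g : G) :
    Tendsto (fun n : ℕ => ∑' S : halfLines hbd,
      |amplitude (linearRamp n) ((g • S : halfLines hbd) : Set ℤ) ^ 2 -
        amplitude (linearRamp n) S ^ 2|) atTop (𝓝 0) := by
  obtain ⟨d, hd⟩ := hbd g
  have hone : Tendsto (fun n : ℕ => 1 / ((n : ℝ) + 1)) atTop (𝓝 0) :=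
    tendsto_one_div_add_atTop_nhds_zero_nat
  set K : ℝ := Real.pi / 2 * d
  have hK : Tendsto (fun n : ℕ => K * (1 / ((n : ℝ) + 1))) atTop (𝓝 0) := by
    simpa using hone.const_mul K
  have hlim : Tendsto (fun n : ℕ => √(4 * (2 * d + 3) * K ^ 2 * (1 / ((n : ℝ) + 1))))
      atTop (𝓝 0) := by
    simpa using (hone.const_mul (4 * (2 * d + 3) * K ^ 2)).sqrt
  refine squeeze_zero' (Eventually.of_forall fun n => tsum_nonneg fun S => abs_nonneg _) ?_ hlim
  filter_upwards [hK.eventually (eventually_le_nhds zero_lt_one)] with n hn1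
  have hn : (0 : ℝ) < n + 1 := by positivity
  have hθ : IsRamp (linearRamp n) (n + 1 + d) := by
    simpa using isRamp_linearRamp_smul (1 : G) n d (by simp)
  have key := tsum_abs_amplitude_sq_sub_le hbd (isRamp_linearRamp_smul g n d hd) hθ hn1 (by
    intro j
    refine (abs_linearRamp_sub_le n _ _).trans ?_
    have : |((g • j - j : ℤ) : ℝ)| ≤ d := by exact_mod_cast hd j
    calc _ ≤ Real.pi / 2 * (d / (n + 1)) := by gcongr
      _ = K * (1 / (n + 1)) := by ring)
  simp only [SubMulAction.val_smul, amplitude_smul]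
  refine key.trans (Real.sqrt_le_sqrt ?_)
  have h1 : (2 * ((n + 1 + d : ℕ) : ℝ) + 1) ≤ (2 * d + 3) * (n + 1) := by
    push_cast
    nlinarith [mul_nonneg (Nat.cast_nonneg (α := ℝ) d) (Nat.cast_nonneg (α := ℝ) n),
      Nat.cast_nonneg (α := ℝ) n]
  calc 4 * (2 * ((n + 1 + d : ℕ) : ℝ) + 1) * (K * (1 / (n + 1))) ^ 2
      ≤ 4 * ((2 * d + 3) * (n + 1)) * (K * (1 / (n + 1))) ^ 2 := by gcongr
    _ = 4 * (2 * d + 3) * K ^ 2 * (1 / (n + 1)) := by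
      field_simp

end

/-- A group acting faithfully on `ℤ` with bounded displacement and recurring patterns is
amenable. -/
theorem isAmenableGroup_of_int_action {G : Type*} [Group G] [MulAction G ℤ]
    [FaithfulSMul G ℤ] (hbd : ∀ g : G, ∃ d : ℕ, ∀ j : ℤ, |g • j - j| ≤ d)
    (hub : ∀ (F : Finset G) (n : ℕ), ∃ k : ℕ, ∀ j : ℤ, ∃ t : ℤ, |t - j| ≤ k ∧
      ∀ g ∈ F, ∀ i : ℤ, |i| ≤ n → g • (i + t) = g • i + t) : IsAmenableGroup G := by
  have hramp : ∀ n : ℕ, IsRamp (linearRamp n) (n + 1) := fun n => by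
    simpa using isRamp_linearRamp_smul (1 : G) n 0 (by simp)
  have hzero : ∀ n : ℕ, ∀ S ∉ halfLineWindow hbd (n + 1),
      amplitude (linearRamp n) (S : Set ℤ) ^ 2 = 0 := fun n S hS => by
    rw [amplitude_eq_zero_of_notMem_window hbd (hramp n) hS, sq, mul_zero]
  refine isAmenableGroup_of_action (X := halfLines hbd)
    (isAmenableGroup_stabilizer_halfLines hbd hub)
    (fun n S => amplitude (linearRamp n) S ^ 2) (fun n => ?_) (fun n S => sq_nonneg _)
    (fun n => ?_) (tendsto_tsum_abs_amplitude_smul_sub hbd)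
  · exact (halfLineWindow hbd (n + 1)).finite_toSet.subset fun S hS => by
      by_contra h
      exact hS (hzero n S h)
  · rw [tsum_eq_sum (hzero n), sum_window_amplitude_sq hbd (hramp n)]

/-! ### Minimal homeomorphisms and the action on an orbit -/

section

variable {C : Type*} [TopologicalSpace C] {T : C ≃ₜ C}

/-- The points whose orbit misses `U` form a closed invariant set, which is not everything. -/
theorem IsMinimalHomeo.exists_zpow_mem (hT : IsMinimalHomeo T) {U : Set C} (hU : IsOpen U)
    (hne : U.Nonempty) (x : C) : ∃ k : ℤ, (T ^ k) x ∈ U := by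
  let A : Set C := {y | ∀ k : ℤ, (T ^ k) y ∉ U}
  have hA : IsClosed A := by
    have : A = ⋂ k : ℤ, (T ^ k) ⁻¹' Uᶜ := by
      ext y
      simp [A]
    rw [this]
    exact isClosed_iInter fun k => hU.isClosed_compl.preimage (T ^ k).continuous
  have hTA : T '' A = A := by
    ext y
    constructor
    · rintro ⟨z, hz, rfl⟩ k
      have := hz (k + 1)
      rwa [zpow_add_one, Homeomorph.mul_apply] at this
    · intro hy
      refine ⟨T⁻¹ y, fun k => ?_, ?_⟩
      · have := hy (k - 1)
        rwa [zpow_sub_one, Homeomorph.mul_apply] at this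
      · rw [← Homeomorph.mul_apply, mul_inv_cancel, Homeomorph.one_apply]
  rcases hT A hA hTA with h | h
  · by_contra! hcon
    exact (h ▸ (show x ∈ A from hcon) : x ∈ (∅ : Set C))
  · obtain ⟨u, hu⟩ := hne
    exact absurd hu (by simpa using (h ▸ Set.mem_univ u : u ∈ A) 0)

/-- A periodic orbit would be finite, hence closed, and would miss its nonempty open complement. -/
theorem IsMinimalHomeo.injective_zpow_apply [T1Space C] [Infinite C] (hT : IsMinimalHomeo T)
    (x : C) : Function.Injective fun k : ℤ => (T ^ k) x := by
  have hfix : ∀ p : ℤ, (T ^ p) x = x → p = 0 := by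
    intro p hp
    by_contra hp0
    have hp' : ((T ^ p)⁻¹) x = x := by
      conv_lhs => rw [← hp]
      rw [← Homeomorph.mul_apply, inv_mul_cancel, Homeomorph.one_apply]
    have hq : ∀ q : ℤ, ((T ^ p) ^ q) x = x := by
      intro q
      induction q using Int.induction_on with
      | zero => rfl
      | succ i hi => rw [zpow_add_one, Homeomorph.mul_apply, hp, hi]
      | pred i hi => rw [zpow_sub_one, Homeomorph.mul_apply, hp', hi]
    let A : Set C := (fun k : ℤ => (T ^ k) x) '' Set.Ico 0 |p|
    have hA : A.Finite := (Set.finite_Ico _ _).image _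
    obtain ⟨k, hk⟩ := hT.exists_zpow_mem hA.isClosed.isOpen_compl hA.infinite_compl.nonempty x
    refine hk ⟨k % p, ⟨Int.emod_nonneg _ hp0, Int.emod_lt_abs _ hp0⟩, ?_⟩
    change (T ^ (k % p)) x = (T ^ k) x
    conv_rhs => rw [← Int.emod_add_mul_ediv k p, zpow_add, Homeomorph.mul_apply, zpow_mul, hq]
  intro a b hab
  have h : (T ^ (-b)) ((T ^ a) x) = (T ^ (-b)) ((T ^ b) x) := congrArg _ hab
  rw [← Homeomorph.mul_apply, ← Homeomorph.mul_apply, ← zpow_add, ← zpow_add, neg_add_cancel,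
    zpow_zero, Homeomorph.one_apply] at h
  have := hfix _ h
  omega

theorem exists_apply_zpow_eq (g : topologicalFullGroup T) (x : C) (j : ℤ) :
    ∃ k : ℤ, (T ^ k) x = (g : C ≃ₜ C) ((T ^ j) x) := by
  obtain ⟨n, -, hn⟩ := g.2
  exact ⟨n ((T ^ j) x) + j, by rw [hn, zpow_add, Homeomorph.mul_apply]⟩

/-- The action of the topological full group on `ℤ`, identified with the orbit of `x`. -/
noncomputable abbrev orbitAction (T : C ≃ₜ C) (x : C)
    (hx : Function.Injective fun k : ℤ => (T ^ k) x) :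
    MulAction (topologicalFullGroup T) ℤ where
  smul g j := (exists_apply_zpow_eq g x j).choose
  one_smul j := hx (exists_apply_zpow_eq 1 x j).choose_spec
  mul_smul g h j := hx <| by
    refine (exists_apply_zpow_eq (g * h) x j).choose_spec.trans ?_
    refine Eq.trans ?_ (exists_apply_zpow_eq g x _).choose_spec.symm
    exact congrArg (g : C ≃ₜ C) (exists_apply_zpow_eq h x j).choose_spec.symm

end

theorem theoremA {C : Type*} [TopologicalSpace C] (hC : IsCantorSpace C)
    (T : C ≃ₜ C) (hT : IsMinimalHomeo T) :
    IsAmenableGroup (topologicalFullGroup T) := by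
  classical
  obtain ⟨e⟩ := hC
  have : CompactSpace C := e.symm.compactSpace
  have : T2Space C := e.symm.t2Space
  have : Infinite C := e.toEquiv.infinite_iff.2 inferInstance
  let x : C := e.symm fun _ => false
  have hx := hT.injective_zpow_apply x
  let := orbitAction T x hx
  have hspec : ∀ (g : topologicalFullGroup T) (j : ℤ),
      (T ^ (g • j)) x = (g : C ≃ₜ C) ((T ^ j) x) := fun g j =>
    (exists_apply_zpow_eq g x j).choose_spec
  choose c hc hcT using fun g : topologicalFullGroup T => g.2
  have hsmul : ∀ (g : topologicalFullGroup T) (j : ℤ), g • j = c g ((T ^ j) x) + j := by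
    intro g j
    refine hx ((hspec g j).trans ?_)
    simp only [zpow_add, Homeomorph.mul_apply]
    exact hcT g _
  -- If two elements differ, they differ on an open set, which the orbit of `x` meets.
  have : FaithfulSMul (topologicalFullGroup T) ℤ := by
    refine ⟨fun {g h} hgh => Subtype.ext (Homeomorph.ext fun y => ?_)⟩
    by_contra hy
    obtain ⟨k, hk⟩ := hT.exists_zpow_mem
      (isOpen_ne_fun (g : C ≃ₜ C).continuous (h : C ≃ₜ C).continuous) ⟨y, hy⟩ x
    exact hk (by rw [← hspec, ← hspec, hgh])
  refine isAmenableGroup_of_int_action (fun g => ?_) fun F n => ?_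
  · obtain ⟨d, hd⟩ := ((hc g).range_finite.image Int.natAbs).bddAbove
    refine ⟨d, fun j => ?_⟩
    rw [hsmul, add_sub_cancel_right, Int.abs_eq_natAbs]
    exact_mod_cast hd (Set.mem_image_of_mem _ (Set.mem_range_self _))
  -- `U` collects the points whose translation numbers match those of `x` on the window. Finitely
  -- many preimages of `U` under powers of `T` cover `C`, which bounds the gaps between returns of
  -- `x` to `U`.
  · let U : Set C := ⋂ g ∈ F, ⋂ i ∈ Finset.Icc (-(n : ℤ)) n,
      {y | c g ((T ^ i) y) = c g ((T ^ i) x)}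
    have hU : IsOpen U := by
      refine isOpen_biInter_finset fun g _ => isOpen_biInter_finset fun i _ => ?_
      exact ((hc g).comp_continuous (T ^ i).continuous).isOpen_fiber _
    have hxU : x ∈ U := by simp [U]
    obtain ⟨s, hs⟩ := isCompact_univ.elim_finite_subcover (fun k : ℤ => (T ^ k) ⁻¹' U)
      (fun k => hU.preimage (T ^ k).continuous) fun y _ =>
        Set.mem_iUnion.2 (hT.exists_zpow_mem hU ⟨x, hxU⟩ y)
    refine ⟨s.sup Int.natAbs, fun j => ?_⟩
    obtain ⟨k, hks, hk⟩ := Set.mem_iUnion₂.1 (hs (Set.mem_univ ((T ^ j) x)))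
    rw [Set.mem_preimage, ← Homeomorph.mul_apply, ← zpow_add] at hk
    refine ⟨k + j, ?_, fun g hg i hi => ?_⟩
    · rw [add_sub_cancel_right, Int.abs_eq_natAbs]
      exact_mod_cast Finset.le_sup (f := Int.natAbs) hks
    · have h := Set.mem_iInter₂.1 (Set.mem_iInter₂.1 hk g hg) i (Finset.mem_Icc.2 (abs_le.1 hi))
      rw [Set.mem_ofPred_eq, ← Homeomorph.mul_apply, ← zpow_add] at h
      rw [hsmul, hsmul, h, add_assoc]
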